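/- Let $n\ge 1$ and $1\le k\le n$ be integers. For a complex $n\times n$ matrix $A$, the rank-$k$ numerical range is $$\Lambda_k(A)=\{\lambda\in\mathbb{C} : PAP=\lambda P \text{ for some orthogonal projection } P\in M_n(\mathbb{C}) \text{ of rank } k\}.$$ Let $S_n$ be the $n$-dimensional shift matrix, i.e. the $n\times n$ matrix with ones on the subdiagonal and zeros elsewhere. Then $$\Lambda_k(S_n)=\Big\{z\in\mathbb{C} : |z|\le \cos\frac{k\pi}{n+1}\Big\}\quad\text{if } 1\le k\le \Big\lfloor\frac{n+1}{2}\Big\rfloor,$$ and $\Lambda_k(S_n)=\emptyset$ if $\lfloor\frac{n+1}{2}\rfloor<k\le n$. (For $n$ odd and $k=\frac{n+1}{2}$ the disc reduces to the point $\{0\}$.) The same holds for the backward shift matrix, which has ones on the superdiagonal and zeros elsewhere. -/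

import Mathlib

/-- The rank-`k` numerical range of an `n × n` complex matrix `A`: all `c : ℂ` such that
`P A P = c P` for some orthogonal projection `P` (`P * P = P` and `Pᴴ = P`) of rank `k`. -/
def rankNumericalRange {n : ℕ} (k : ℕ) (A : Matrix (Fin n) (Fin n) ℂ) : Set ℂ :=
  {c : ℂ | ∃ P : Matrix (Fin n) (Fin n) ℂ,
    IsStarProjection P ∧ P.rank = k ∧ P * A * P = c • P}

/-- The shift matrix: ones on the subdiagonal and zeros elsewhere. -/
def shiftMatrix (n : ℕ) : Matrix (Fin n) (Fin n) ℂ :=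
  Matrix.of fun i j => if (i : ℕ) = (j : ℕ) + 1 then 1 else 0

/-- The backward shift matrix: ones on the superdiagonal and zeros elsewhere. -/
def backwardShiftMatrix (n : ℕ) : Matrix (Fin n) (Fin n) ℂ :=
  Matrix.of fun i j => if (j : ℕ) = (i : ℕ) + 1 then 1 else 0

open Matrix
open scoped ComplexOrder

/-! Projections can be traded for arbitrary bases of their ranges, and conjugation by diagonal
unitaries makes the range rotation invariant, so only real `c = r ≥ 0` matters.

Upper bound: `S + Sᵀ` has the discrete sine vectors as orthogonal eigenvectors, with eigenvalues `2
cos θ_j`. As in Courant-Fischer, a `(k + 1)`-dimensional subspace contains a nonzero vector built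
only from eigenvectors with `j ≥ k`, whence `r ≤ cos θ_k`.

Lower bound, `r > 0`: choose `w_j` in `(0, 1]` with `r (1 + w_j²) = 2 w_j cos θ_j`. The sines damped
by `w_j` satisfy `(S - r) x = -w_j² (Sᵀ - r) x`, which makes them independent and their span
isotropic for `S - r`. The point `0` is handled by alternate basis vectors. Emptiness is the case
`cos θ_k < 0`. -/

/-! ### Compressions by matrices of full column rank -/

theorem eq_zero_of_mulVec_eq_zero_of_rank_eq {K : Type*} [Field K] {n k : ℕ}
    {M : Matrix (Fin n) (Fin k) K} (hM : M.rank = k) {v : Fin k → K} (hv : M *ᵥ v = 0) :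
    v = 0 := by
  have h1 := LinearMap.finrank_range_add_finrank_ker M.mulVecLin
  have h2 : Module.finrank K (LinearMap.range M.mulVecLin) = k := hM
  rw [h2, Module.finrank_fin_fun] at h1
  have h3 : LinearMap.ker M.mulVecLin = ⊥ := by
    rw [← Submodule.finrank_eq_zero (R := K)]
    omega
  exact LinearMap.ker_eq_bot'.mp h3 v hv

/-- A matrix of full column rank compressing `A` to `c` witnesses membership of `c` in the
rank-`k` numerical range. -/
theorem mem_rankNumericalRange_iff {n k : ℕ} {A : Matrix (Fin n) (Fin n) ℂ} {c : ℂ} :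
    c ∈ rankNumericalRange k A ↔
      ∃ M : Matrix (Fin n) (Fin k) ℂ, M.rank = k ∧ Mᴴ * A * M = c • (Mᴴ * M) := by
  constructor
  · rintro ⟨P, hP, hr, h⟩
    have hPP : P * P = P := hP.isIdempotentElem
    have hPH : Pᴴ = P := hP.isSelfAdjoint
    let b := Module.finBasisOfFinrankEq ℂ (LinearMap.range P.mulVecLin) hr
    let x : Fin k → Fin n → ℂ := fun j => (b j : Fin n → ℂ)
    have hx : LinearIndependent ℂ x :=
      b.linearIndependent.map' (Submodule.subtype _) (Submodule.ker_subtype _)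
    have hPx : ∀ j, P *ᵥ x j = x j := by
      intro j
      obtain ⟨y, hy⟩ := (b j).2
      have : x j = P *ᵥ y := hy.symm
      rw [this, mulVec_mulVec, hPP]
    have hPM : P * (Matrix.of x)ᵀ = (Matrix.of x)ᵀ := by
      ext i j
      exact congrFun (hPx j) i
    refine ⟨(Matrix.of x)ᵀ, ?_, ?_⟩
    · rw [rank_transpose]
      simpa using LinearIndependent.rank_matrix (M := Matrix.of x) hx
    · generalize (Matrix.of x)ᵀ = M at hPM
      have hMP : Mᴴ * P = Mᴴ := by
        have := congrArg conjTranspose hPM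
        rwa [conjTranspose_mul, hPH] at this
      calc Mᴴ * A * M = Mᴴ * P * A * (P * M) := by rw [hMP, hPM]
        _ = Mᴴ * (P * A * P) * M := by simp only [Matrix.mul_assoc]
        _ = c • (Mᴴ * P * M) := by rw [h]; simp
        _ = c • (Mᴴ * M) := by rw [hMP]
  · rintro ⟨M, hr, h⟩
    set G := Mᴴ * M with hG
    have hGd : IsUnit G.det := by
      have hGr : G.rank = k := by rw [hG, rank_conjTranspose_mul_self, hr]
      rw [isUnit_iff_ne_zero]
      intro h0
      obtain ⟨v, hv, hv0⟩ := Matrix.exists_mulVec_eq_zero_iff.mpr h0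
      exact hv (eq_zero_of_mulVec_eq_zero_of_rank_eq hGr hv0)
    have hGH : Gᴴ = G := by rw [hG, conjTranspose_mul, conjTranspose_conjTranspose]
    have h1 : G⁻¹ * G = 1 := nonsing_inv_mul G hGd
    have hPM : M * G⁻¹ * Mᴴ * M = M := by
      rw [Matrix.mul_assoc, ← hG, Matrix.mul_assoc, h1, Matrix.mul_one]
    -- The orthogonal projection onto the column space of `M`; the Gram matrix `G` corrects for
    -- non-orthonormal columns.
    refine ⟨M * G⁻¹ * Mᴴ, ⟨?_, ?_⟩, ?_, ?_⟩
    · calc M * G⁻¹ * Mᴴ * (M * G⁻¹ * Mᴴ) = (M * G⁻¹ * Mᴴ * M) * G⁻¹ * Mᴴ := by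
            simp only [Matrix.mul_assoc]
        _ = _ := by rw [hPM]
    · change (M * G⁻¹ * Mᴴ)ᴴ = _
      simp only [conjTranspose_mul, conjTranspose_conjTranspose, conjTranspose_nonsing_inv, hGH,
        Matrix.mul_assoc]
    · apply le_antisymm
      · rw [Matrix.mul_assoc]
        exact (rank_mul_le_left _ _).trans_eq hr
      · have := rank_mul_le_left (M * G⁻¹ * Mᴴ) M
        rwa [hPM, hr] at this
    · calc M * G⁻¹ * Mᴴ * A * (M * G⁻¹ * Mᴴ) = M * G⁻¹ * (Mᴴ * A * M) * G⁻¹ * Mᴴ := by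
            simp only [Matrix.mul_assoc]
        _ = c • (M * (G⁻¹ * G) * G⁻¹ * Mᴴ) := by rw [h]; simp [Matrix.mul_assoc]
        _ = _ := by rw [h1, Matrix.mul_one]

theorem mem_rankNumericalRange_conjTranspose {n k : ℕ} {A : Matrix (Fin n) (Fin n) ℂ} {c : ℂ}
    (h : c ∈ rankNumericalRange k A) : star c ∈ rankNumericalRange k Aᴴ := by
  obtain ⟨P, hP, hr, h⟩ := h
  have hPH : Pᴴ = P := hP.isSelfAdjoint
  refine ⟨P, hP, hr, ?_⟩
  have := congrArg conjTranspose h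
  simpa [conjTranspose_mul, hPH, Matrix.mul_assoc] using this

/-! ### The shift: action on sequences and rotational symmetry -/

theorem backwardShiftMatrix_eq_transpose (n : ℕ) :
    backwardShiftMatrix n = (shiftMatrix n)ᵀ := rfl

theorem conjTranspose_shiftMatrix (n : ℕ) : (shiftMatrix n)ᴴ = (shiftMatrix n)ᵀ := by
  ext i j
  simp only [conjTranspose_apply, transpose_apply, shiftMatrix, of_apply]
  split_ifs <;> simp

/-- Vectors hold the values `f 1, ..., f n`; the boundary value `f 0 = 0` absorbs the truncation. -/
theorem shiftMatrix_mulVec {n : ℕ} (f : ℕ → ℂ) (h0 : f 0 = 0) (i : Fin n) :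
    (shiftMatrix n *ᵥ fun j => f (j + 1)) i = f i := by
  obtain ⟨i, hi⟩ := i
  simp only [mulVec, dotProduct, shiftMatrix, of_apply, ite_mul, one_mul, zero_mul]
  rcases i with _ | m
  · rw [h0]
    exact Finset.sum_eq_zero fun j _ => if_neg (by simp)
  · rw [Finset.sum_eq_single (⟨m, by omega⟩ : Fin n)]
    · simp
    · intro j _ hj
      refine if_neg fun h => hj (Fin.ext ?_)
      simp only at h ⊢
      omega
    · simp

theorem shiftMatrix_transpose_mulVec {n : ℕ} (f : ℕ → ℂ) (hn : f (n + 1) = 0) (i : Fin n) :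
    ((shiftMatrix n)ᵀ *ᵥ fun j => f (j + 1)) i = f (i + 2) := by
  obtain ⟨i, hi⟩ := i
  simp only [mulVec, dotProduct, transpose_apply, shiftMatrix, of_apply, ite_mul, one_mul,
    zero_mul]
  by_cases hin : i + 1 = n
  · rw [show i + 2 = n + 1 by omega, hn]
    refine Finset.sum_eq_zero fun j _ => if_neg ?_
    omega
  · rw [Finset.sum_eq_single (⟨i + 1, by omega⟩ : Fin n)]
    · simp
    · intro j _ hj
      refine if_neg fun h => hj (Fin.ext ?_)
      simp only at h ⊢
      omega
    · simp

/-- The rank-`k` numerical range of the shift matrix is invariant under rotations. -/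
theorem mul_mem_rankNumericalRange_shiftMatrix {n k : ℕ} {c u : ℂ} (hu : star u * u = 1)
    (h : c ∈ rankNumericalRange k (shiftMatrix n)) :
    u * c ∈ rankNumericalRange k (shiftMatrix n) := by
  rw [mem_rankNumericalRange_iff] at h ⊢
  obtain ⟨M, hr, h⟩ := h
  let D : Matrix (Fin n) (Fin n) ℂ := diagonal fun i => star u ^ (i : ℕ)
  have hD : Dᴴ * D = 1 := by
    rw [diagonal_conjTranspose, diagonal_mul_diagonal, ← diagonal_one]
    congr 1
    ext i
    simp only [Pi.star_apply, star_pow, star_star]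
    rw [← mul_pow, mul_comm, hu, one_pow]
  have hSD : shiftMatrix n * D = u • (D * shiftMatrix n) := by
    ext i j
    rw [mul_diagonal, Matrix.smul_apply, diagonal_mul, smul_eq_mul, shiftMatrix, of_apply]
    split_ifs with hij
    · rw [hij, pow_succ]
      linear_combination (-(star u) ^ (j : ℕ)) * hu
    · simp
  refine ⟨D * M, ?_, ?_⟩
  · rw [← rank_conjTranspose_mul_self, conjTranspose_mul, Matrix.mul_assoc, ← Matrix.mul_assoc Dᴴ,
      hD, Matrix.one_mul, rank_conjTranspose_mul_self, hr]
  · calc (D * M)ᴴ * shiftMatrix n * (D * M) = Mᴴ * Dᴴ * (shiftMatrix n * D) * M := by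
          simp only [conjTranspose_mul, Matrix.mul_assoc]
      _ = u • (Mᴴ * (Dᴴ * D) * shiftMatrix n * M) := by
          rw [hSD]; simp [Matrix.mul_assoc]
      _ = (u * c) • (Mᴴ * (Dᴴ * D) * M) := by rw [hD]; simp [h, mul_smul]
      _ = (u * c) • ((D * M)ᴴ * (D * M)) := by simp only [conjTranspose_mul, Matrix.mul_assoc]

/-! ### Angles and damped sine vectors -/

/-- The angle `(j + 1) π / (n + 1)`. -/
noncomputable def shiftAngle (n j : ℕ) : ℝ := (j + 1) * Real.pi / (n + 1)

theorem shiftAngle_strictMono (n : ℕ) : StrictMono (shiftAngle n) := by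
  intro i j hij
  have : (i : ℝ) < j := by exact_mod_cast hij
  unfold shiftAngle
  gcongr

theorem shiftAngle_mem_Ioo {n j : ℕ} (hj : j < n) : shiftAngle n j ∈ Set.Ioo 0 Real.pi := by
  have : (j : ℝ) < n := by exact_mod_cast hj
  have hn : (0 : ℝ) < n + 1 := by positivity
  constructor
  · unfold shiftAngle; positivity
  · rw [shiftAngle, div_lt_iff₀ hn]
    nlinarith [Real.pi_pos]

theorem cos_shiftAngle_lt {n i j : ℕ} (hij : i < j) (hj : j < n) :
    Real.cos (shiftAngle n j) < Real.cos (shiftAngle n i) :=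
  Real.strictAntiOn_cos (Set.Ioo_subset_Icc_self (shiftAngle_mem_Ioo (hij.trans hj)))
    (Set.Ioo_subset_Icc_self (shiftAngle_mem_Ioo hj)) (shiftAngle_strictMono n hij)

theorem cos_shiftAngle_le {n i j : ℕ} (hij : i ≤ j) (hj : j < n) :
    Real.cos (shiftAngle n j) ≤ Real.cos (shiftAngle n i) := by
  rcases hij.eq_or_lt with rfl | h
  · exact le_rfl
  · exact (cos_shiftAngle_lt h hj).le

theorem eq_of_cos_shiftAngle_eq {n i j : ℕ} (hi : i < n) (hj : j < n)
    (h : Real.cos (shiftAngle n i) = Real.cos (shiftAngle n j)) : i = j := by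
  rcases lt_trichotomy i j with h' | h' | h'
  · exact absurd h (cos_shiftAngle_lt h' hj).ne'
  · exact h'
  · exact absurd h (cos_shiftAngle_lt h' hi).ne

theorem sin_succ_mul_shiftAngle (n j : ℕ) :
    Real.sin (((n + 1 : ℕ) : ℝ) * shiftAngle n j) = 0 := by
  have : ((n + 1 : ℕ) : ℝ) * shiftAngle n j = ((j + 1 : ℕ) : ℝ) * Real.pi := by
    unfold shiftAngle
    push_cast
    field_simp
  rw [this, Real.sin_nat_mul_pi]

/-- The discrete sine wave of frequency `shiftAngle n j`, rescaled geometrically by `w⁻¹`. -/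
noncomputable def dampedSine (n j : ℕ) (w : ℝ) (m : ℕ) : ℂ :=
  ((w⁻¹ ^ m * Real.sin (m * shiftAngle n j) : ℝ) : ℂ)

/-- `dampedSine` as a vector of length `n`. -/
noncomputable def dampedSineVec (n j : ℕ) (w : ℝ) (i : Fin n) : ℂ := dampedSine n j w (i + 1)

/-- This is `sin (a - θ) + sin (a + θ) = 2 cos θ sin a` at `a = (m + 1) θ`, scaled by `w⁻¹ ^ m`. -/
theorem dampedSine_recurrence (n j m : ℕ) {w : ℝ} (hw : w ≠ 0) :
    dampedSine n j w m + (w : ℂ) ^ 2 * dampedSine n j w (m + 2) =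
      (2 * w * Real.cos (shiftAngle n j) : ℝ) * dampedSine n j w (m + 1) := by
  simp only [dampedSine]
  norm_cast
  set θ := shiftAngle n j
  have h1 : Real.sin ((m + 1 : ℕ) * θ - θ) + Real.sin ((m + 1 : ℕ) * θ + θ)
      = 2 * Real.cos θ * Real.sin ((m + 1 : ℕ) * θ) := by
    rw [Real.sin_sub, Real.sin_add]; ring
  rw [show ((m + 1 : ℕ) : ℝ) * θ - θ = m * θ by push_cast; ring,
    show ((m + 1 : ℕ) : ℝ) * θ + θ = (m + 2 : ℕ) * θ by push_cast; ring] at h1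
  have h2 : w⁻¹ ^ (m + 1) * w = w⁻¹ ^ m := by rw [pow_succ]; field_simp
  have h3 : w⁻¹ ^ (m + 2) * w ^ 2 = w⁻¹ ^ m := by rw [pow_add]; field_simp
  linear_combination w⁻¹ ^ m * h1 + Real.sin ((m + 2 : ℕ) * θ) * h3
    - 2 * Real.cos θ * Real.sin ((m + 1 : ℕ) * θ) * h2

theorem shiftMatrix_add_smul_transpose_mulVec (n j : ℕ) {w : ℝ} (hw : w ≠ 0) :
    (shiftMatrix n *ᵥ dampedSineVec n j w)
      + (w : ℂ) ^ 2 • ((shiftMatrix n)ᵀ *ᵥ dampedSineVec n j w) =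
      ((2 * w * Real.cos (shiftAngle n j) : ℝ) : ℂ) • dampedSineVec n j w := by
  ext i
  have h0 : dampedSine n j w 0 = 0 := by simp [dampedSine]
  have hn : dampedSine n j w (n + 1) = 0 := by
    simp only [dampedSine, sin_succ_mul_shiftAngle, mul_zero, Complex.ofReal_zero]
  have h1 := shiftMatrix_mulVec _ h0 i
  have h2 := shiftMatrix_transpose_mulVec _ hn i
  have h3 := dampedSine_recurrence n j i hw
  simp only [Pi.add_apply, Pi.smul_apply, smul_eq_mul]
  rw [← h1, ← h2] at h3
  exact h3

theorem dampedSineVec_ne_zero {n j : ℕ} (hj : j < n) {w : ℝ} (hw : w ≠ 0) :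
    dampedSineVec n j w ≠ 0 := by
  intro h
  have h1 := congrFun h ⟨0, by omega⟩
  have h2 := Real.sin_pos_of_mem_Ioo (shiftAngle_mem_Ioo hj)
  simp only [dampedSineVec, dampedSine, Pi.zero_apply, Complex.ofReal_eq_zero, zero_add, pow_one,
    Nat.cast_one, one_mul, mul_eq_zero, inv_eq_zero] at h1
  rcases h1 with h1 | h1
  · exact hw h1
  · exact h2.ne' h1

theorem star_dampedSineVec (n j : ℕ) (w : ℝ) (i : Fin n) :
    star (dampedSineVec n j w i) = dampedSineVec n j w i :=
  Complex.conj_ofReal _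

/-! ### Upper bound from the spectrum of `S + Sᵀ` -/

/-- The unnormalised discrete sine transform diagonalises `S + Sᵀ`. -/
noncomputable def sineMatrix (n : ℕ) : Matrix (Fin n) (Fin n) ℂ :=
  Matrix.of fun i j => dampedSineVec n j 1 i

theorem shiftMatrix_add_transpose_mul_sineMatrix (n : ℕ) :
    (shiftMatrix n + (shiftMatrix n)ᵀ) * sineMatrix n =
      sineMatrix n *
        diagonal fun j : Fin n => ((2 * Real.cos (shiftAngle n j) : ℝ) : ℂ) := by
  ext i j
  have h := congrFun (shiftMatrix_add_smul_transpose_mulVec n j (one_ne_zero (α := ℝ))) i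
  rw [Complex.ofReal_one, one_pow, one_smul, ← add_mulVec, mul_one] at h
  rw [mul_diagonal, mul_comm (sineMatrix n i j)]
  exact h

/-- Since `S + Sᵀ` is Hermitian, the Gram matrix commutes with a diagonal matrix whose entries are
distinct, so its off-diagonal entries vanish. -/
theorem exists_conjTranspose_mul_sineMatrix_eq_diagonal (n : ℕ) :
    ∃ d : Fin n → ℝ, (∀ j, 0 < d j) ∧
      (sineMatrix n)ᴴ * sineMatrix n = diagonal fun j => (d j : ℂ) := by
  set W := sineMatrix n with hW
  set L : Matrix (Fin n) (Fin n) ℂ :=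
    diagonal fun j : Fin n => ((2 * Real.cos (shiftAngle n j) : ℝ) : ℂ) with hL
  have h1 : (shiftMatrix n + (shiftMatrix n)ᵀ) * W = W * L :=
    shiftMatrix_add_transpose_mul_sineMatrix n
  have hTH : (shiftMatrix n + (shiftMatrix n)ᵀ)ᴴ = shiftMatrix n + (shiftMatrix n)ᵀ := by
    rw [conjTranspose_add, ← conjTranspose_shiftMatrix, conjTranspose_conjTranspose, add_comm]
  have hLH : Lᴴ = L := by
    rw [hL, diagonal_conjTranspose]
    congr 1
    ext j
    exact Complex.conj_ofReal _
  have hcomm : Wᴴ * W * L = L * (Wᴴ * W) := by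
    rw [Matrix.mul_assoc, ← h1, ← Matrix.mul_assoc, ← hTH, ← conjTranspose_mul, h1,
      conjTranspose_mul, hLH, Matrix.mul_assoc]
  refine ⟨fun j => ∑ i, ‖W i j‖ ^ 2, fun j => ?_, ?_⟩
  · obtain ⟨i, hi⟩ := Function.ne_iff.mp (dampedSineVec_ne_zero j.2 (one_ne_zero (α := ℝ)))
    have hi' : 0 < ‖W i j‖ := norm_pos_iff.mpr hi
    exact Finset.sum_pos' (fun _ _ => by positivity) ⟨i, Finset.mem_univ _, by positivity⟩
  · ext i j
    by_cases hij : i = j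
    · subst hij
      rw [diagonal_apply_eq, mul_apply]
      push_cast
      refine Finset.sum_congr rfl fun m _ => ?_
      rw [conjTranspose_apply]
      exact Complex.conj_mul' _
    · rw [diagonal_apply_ne _ hij]
      have h2 := congrFun (congrFun hcomm i) j
      rw [hL, mul_diagonal, diagonal_mul, mul_comm, mul_eq_mul_right_iff] at h2
      refine h2.resolve_left fun h3 => hij (Fin.ext ?_)
      have h4 := Complex.ofReal_injective h3
      exact (eq_of_cos_shiftAngle_eq j.2 i.2 (by linarith)).symm

theorem isUnit_det_sineMatrix (n : ℕ) : IsUnit (sineMatrix n).det := by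
  obtain ⟨d, hd, h⟩ := exists_conjTranspose_mul_sineMatrix_eq_diagonal n
  have h1 := congrArg det h
  rw [det_mul, det_diagonal] at h1
  rw [isUnit_iff_ne_zero]
  intro h0
  rw [h0, mul_zero] at h1
  exact Finset.prod_ne_zero_iff.mpr (fun j _ => Complex.ofReal_ne_zero.mpr (hd j).ne') h1.symm

theorem star_dotProduct_diagonal_mulVec {n : ℕ} (d : Fin n → ℝ) (a : Fin n → ℂ) :
    star a ⬝ᵥ (diagonal (fun j => (d j : ℂ)) *ᵥ a) = ((∑ j, d j * ‖a j‖ ^ 2 : ℝ) : ℂ) := by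
  push_cast
  refine Finset.sum_congr rfl fun j _ => ?_
  rw [mulVec_diagonal, Pi.star_apply]
  have : star (a j) * a j = (‖a j‖ : ℂ) ^ 2 := Complex.conj_mul' _
  linear_combination (d j : ℂ) * this

/-- A real point of the rank-`(k + 1)` numerical range of the shift is bounded by the
`(k + 1)`-st largest eigenvalue of its real part. -/
theorem le_cos_of_ofReal_mem_rankNumericalRange_shiftMatrix {n k : ℕ} (hk : k < n) {r : ℝ}
    (h : (r : ℂ) ∈ rankNumericalRange (k + 1) (shiftMatrix n)) :
    r ≤ Real.cos (shiftAngle n k) := by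
  obtain ⟨M, hr, h⟩ := mem_rankNumericalRange_iff.mp h
  obtain ⟨d, hd, hD⟩ := exists_conjTranspose_mul_sineMatrix_eq_diagonal n
  set W := sineMatrix n
  set N := W⁻¹ * M with hN
  have hM : M = W * N := by
    rw [hN, ← Matrix.mul_assoc, mul_nonsing_inv _ (isUnit_det_sineMatrix n), Matrix.one_mul]
  have hT : Mᴴ * (shiftMatrix n + (shiftMatrix n)ᵀ) * M = (r : ℂ) • (Mᴴ * M + Mᴴ * M) := by
    have h' := congrArg conjTranspose h
    simp only [conjTranspose_mul, conjTranspose_smul, conjTranspose_conjTranspose,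
      conjTranspose_shiftMatrix, ← Matrix.mul_assoc, Complex.star_def, Complex.conj_ofReal] at h'
    rw [Matrix.mul_add, Matrix.add_mul, h, h', smul_add]
  have hMM : Mᴴ * M = Nᴴ * diagonal (fun j => (d j : ℂ)) * N := by
    rw [hM, ← hD, conjTranspose_mul]
    simp only [Matrix.mul_assoc]
  have hMTM : Mᴴ * (shiftMatrix n + (shiftMatrix n)ᵀ) * M =
      Nᴴ * diagonal (fun j => ((d j * (2 * Real.cos (shiftAngle n j)) : ℝ) : ℂ)) * N := by
    calc Mᴴ * (shiftMatrix n + (shiftMatrix n)ᵀ) * M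
        = Nᴴ * (Wᴴ * ((shiftMatrix n + (shiftMatrix n)ᵀ) * W)) * N := by
          rw [hM, conjTranspose_mul]
          simp only [Matrix.mul_assoc]
      _ = _ := by
          rw [shiftMatrix_add_transpose_mul_sineMatrix, ← Matrix.mul_assoc Wᴴ, hD,
            diagonal_mul_diagonal]
          simp only [Complex.ofReal_mul]
  -- `k` linear conditions on `k + 1` unknowns.
  obtain ⟨v, hv, hv0⟩ : ∃ v : Fin (k + 1) → ℂ, v ≠ 0 ∧
      ∀ j : Fin n, (j : ℕ) < k → (N *ᵥ v) j = 0 := by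
    have hker := LinearMap.ker_ne_bot_of_finrank_lt
      (f := (N.submatrix (Fin.castLE hk.le) id).mulVecLin) (by simp)
    obtain ⟨v, hv, hv0⟩ := Submodule.exists_mem_ne_zero_of_ne_bot hker
    exact ⟨v, hv0, fun j hj => congrFun (LinearMap.mem_ker.mp hv) ⟨j, hj⟩⟩
  set a := N *ᵥ v with ha
  have ha0 : a ≠ 0 := by
    intro h0
    refine hv (eq_zero_of_mulVec_eq_zero_of_rank_eq hr ?_)
    rw [hM, ← mulVec_mulVec, ← ha, h0, mulVec_zero]
  have hquad : ∀ e : Fin n → ℝ, star v ⬝ᵥ ((Nᴴ * diagonal (fun j => (e j : ℂ)) * N) *ᵥ v) =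
      ((∑ j, e j * ‖a j‖ ^ 2 : ℝ) : ℂ) := by
    intro e
    rw [← star_dotProduct_diagonal_mulVec, ← mulVec_mulVec, ← mulVec_mulVec, dotProduct_mulVec,
      ← star_mulVec]
  have key := congrArg (fun X => star v ⬝ᵥ (X *ᵥ v)) hT
  simp only [smul_mulVec, add_mulVec, dotProduct_smul, dotProduct_add, smul_eq_mul] at key
  rw [hMTM, hMM, hquad, hquad] at key
  norm_cast at key
  by_contra! hlt
  have hsum : ∑ j, d j * (r - Real.cos (shiftAngle n j)) * ‖a j‖ ^ 2 = 0 := by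
    have : ∑ j, d j * (r - Real.cos (shiftAngle n j)) * ‖a j‖ ^ 2 =
        r * ∑ j, d j * ‖a j‖ ^ 2 -
          (∑ j, d j * (2 * Real.cos (shiftAngle n j)) * ‖a j‖ ^ 2) / 2 := by
      rw [Finset.mul_sum, Finset.sum_div, ← Finset.sum_sub_distrib]
      exact Finset.sum_congr rfl fun j _ => by ring
    rw [this, key]
    ring
  have hpos : ∀ j : Fin n, a j ≠ 0 → 0 < d j * (r - Real.cos (shiftAngle n j)) := by
    intro j hj
    have hkj : k ≤ (j : ℕ) := by
      by_contra! hjk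
      exact hj (hv0 j hjk)
    have := cos_shiftAngle_le hkj j.2
    exact mul_pos (hd j) (by linarith)
  have hnonneg : ∀ j ∈ Finset.univ, 0 ≤ d j * (r - Real.cos (shiftAngle n j)) * ‖a j‖ ^ 2 := by
    intro j _
    by_cases hj : a j = 0
    · simp [hj]
    · have := hpos j hj
      positivity
  obtain ⟨j, hj⟩ := Function.ne_iff.mp ha0
  have h0 := (Finset.sum_eq_zero_iff_of_nonneg hnonneg).mp hsum j (Finset.mem_univ _)
  have h1 := hpos j hj
  have h2 : 0 < ‖a j‖ := norm_pos_iff.mpr hj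
  exact absurd h0 (by positivity)

/-! ### Lower bound from isotropic subspaces -/

theorem zero_mem_rankNumericalRange_shiftMatrix {n k : ℕ} (hk : 2 * k ≤ n + 1) :
    (0 : ℂ) ∈ rankNumericalRange k (shiftMatrix n) := by
  rw [mem_rankNumericalRange_iff]
  -- The shift sends even-indexed basis vectors to odd-indexed ones or to zero.
  let e : Fin k → Fin n := fun i => ⟨2 * i, by omega⟩
  have he : Function.Injective e := fun i j h => by
    have := congrArg Fin.val h
    simp only [e] at this
    omega
  have h1 : ∀ A : Matrix (Fin n) (Fin n) ℂ,
      ((1 : Matrix (Fin n) (Fin n) ℂ).submatrix id e)ᴴ * A *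
        (1 : Matrix (Fin n) (Fin n) ℂ).submatrix id e = A.submatrix e e := by
    intro A
    rw [conjTranspose_submatrix, conjTranspose_one]
    conv_lhs => rw [← submatrix_id_id A]
    rw [← submatrix_mul _ _ _ _ _ Function.bijective_id,
      ← submatrix_mul _ _ _ _ _ Function.bijective_id, Matrix.one_mul, Matrix.mul_one]
  refine ⟨(1 : Matrix (Fin n) (Fin n) ℂ).submatrix id e, ?_, ?_⟩
  · have h2 := h1 1
    rw [Matrix.mul_one, submatrix_one _ he] at h2
    rw [← rank_conjTranspose_mul_self, h2, rank_one, Fintype.card_fin]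
  · rw [h1, zero_smul]
    ext i j
    simp only [submatrix_apply, shiftMatrix, of_apply, Matrix.zero_apply, e]
    exact if_neg (by omega)

/-- The smaller root of `r w² - 2 l w + r`; the two roots are positive with product `1`. -/
theorem exists_ratio {r l : ℝ} (hr : 0 < r) (hl : r ≤ l) :
    ∃ w : ℝ, 0 < w ∧ w ≤ 1 ∧ r * (1 + w ^ 2) = 2 * w * l := by
  have hs := Real.sq_sqrt (show 0 ≤ l ^ 2 - r ^ 2 by nlinarith)
  have hs0 := Real.sqrt_nonneg (l ^ 2 - r ^ 2)
  set s := √(l ^ 2 - r ^ 2)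
  have hsl : s < l := by nlinarith
  refine ⟨(l - s) / r, div_pos (by linarith) hr, ?_, ?_⟩
  · rw [div_le_one hr]
    nlinarith
  · field_simp
    nlinarith

theorem det_transpose_shiftMatrix_sub_smul_one (n : ℕ) (c : ℂ) :
    ((shiftMatrix n)ᵀ - c • (1 : Matrix (Fin n) (Fin n) ℂ)).det = (-c) ^ n := by
  rw [det_of_isUpperTriangular]
  · simp [shiftMatrix]
  · intro i j hij
    have hij' : j < i := hij
    have h1 : ¬ ((j : ℕ) = i + 1) := by omega
    simp [shiftMatrix, hij'.ne', h1]

/-- Positive real points: the damped sine vectors are eigenvectors of the pencil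
`S - r + w² (Sᵀ - r)`, and span a subspace on which `S - r` vanishes as a form. -/
theorem ofReal_mem_rankNumericalRange_shiftMatrix {n k : ℕ} (hk : k < n) {r : ℝ} (hr : 0 < r)
    (hrk : r ≤ Real.cos (shiftAngle n k)) :
    (r : ℂ) ∈ rankNumericalRange (k + 1) (shiftMatrix n) := by
  rw [mem_rankNumericalRange_iff]
  have hjn : ∀ j : Fin (k + 1), (j : ℕ) < n := fun j => by omega
  have hex : ∀ j : Fin (k + 1), ∃ w : ℝ, 0 < w ∧ w ≤ 1 ∧
      r * (1 + w ^ 2) = 2 * w * Real.cos (shiftAngle n j) := fun j =>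
    exists_ratio hr (hrk.trans (cos_shiftAngle_le (by omega) hk))
  choose w hw0 hw1 hw using hex
  have hwinj : Function.Injective w := by
    intro i j hij
    have h1 := hw i
    rw [hij, hw j] at h1
    have h2 : (2 * w j) ≠ 0 := by have := hw0 j; positivity
    exact Fin.ext (eq_of_cos_shiftAngle_eq (hjn i) (hjn j) (mul_left_cancel₀ h2 h1).symm)
  let x : Fin (k + 1) → Fin n → ℂ := fun j => dampedSineVec n j (w j)
  set A : Matrix (Fin n) (Fin n) ℂ := shiftMatrix n - (r : ℂ) • 1 with hA
  have hAT : Aᵀ = (shiftMatrix n)ᵀ - (r : ℂ) • 1 := by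
    rw [hA, transpose_sub, transpose_smul, transpose_one]
  have hdet : IsUnit Aᵀ.det := by
    rw [hAT, det_transpose_shiftMatrix_sub_smul_one, isUnit_iff_ne_zero]
    exact pow_ne_zero _ (neg_ne_zero.mpr (Complex.ofReal_ne_zero.mpr hr.ne'))
  have hpencil : ∀ j, A *ᵥ x j = (-(w j : ℂ) ^ 2) • (Aᵀ *ᵥ x j) := by
    intro j
    have h1 := shiftMatrix_add_smul_transpose_mulVec n j (hw0 j).ne'
    rw [← hw j] at h1
    rw [hAT, hA, sub_mulVec, sub_mulVec, smul_mulVec, one_mulVec]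
    push_cast at h1
    ext i
    have h2 := congrFun h1 i
    simp only [Pi.add_apply, Pi.sub_apply, Pi.smul_apply, smul_eq_mul] at h2 ⊢
    linear_combination h2
  -- The `x j` are eigenvectors of `(Aᵀ)⁻¹ * A` for the distinct eigenvalues `-w j ^ 2`.
  have hLI : LinearIndependent ℂ x := by
    refine Module.End.eigenvectors_linearIndependent' (Matrix.toLin' ((Aᵀ)⁻¹ * A))
      (fun j => -(w j : ℂ) ^ 2) ?_ x fun j => ⟨?_, dampedSineVec_ne_zero (hjn j) (hw0 j).ne'⟩
    · intro i j hij
      have h1 : w i ^ 2 = w j ^ 2 := by exact_mod_cast neg_injective hij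
      exact hwinj ((sq_eq_sq₀ (hw0 i).le (hw0 j).le).mp h1)
    · rw [Module.End.mem_eigenspace_iff, Matrix.toLin'_apply, ← mulVec_mulVec, hpencil,
        mulVec_smul, mulVec_mulVec, nonsing_inv_mul _ hdet, one_mulVec]
  have hform : ∀ i j, x i ⬝ᵥ (A *ᵥ x j) = -((w j : ℂ) ^ 2) * (x j ⬝ᵥ (A *ᵥ x i)) := by
    intro i j
    rw [hpencil j, dotProduct_smul, smul_eq_mul, mulVec_transpose, dotProduct_comm (x i),
      ← dotProduct_mulVec]
  -- Applying `hform` twice multiplies the value by `(w i * w j) ^ 2`, which is below `1` for `i ≠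
  -- j` because at most one `w` equals `1`. On the diagonal one application suffices.
  have hzero : ∀ i j, x i ⬝ᵥ (A *ᵥ x j) = 0 := by
    intro i j
    by_cases hij : i = j
    · subst hij
      have h1 := hform i i
      have h2 : ((1 + w i ^ 2 : ℝ) : ℂ) ≠ 0 := by
        have := hw0 i
        exact Complex.ofReal_ne_zero.mpr (by positivity)
      refine (mul_eq_zero.mp ?_).resolve_left h2
      push_cast
      linear_combination h1
    · have h1 := hform i j
      rw [hform j i] at h1
      have h2 : w i * w j < 1 := by
        rcases (hw1 i).lt_or_eq with h | h
        · nlinarith [hw0 i, hw0 j, hw1 j]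
        · have h3 : w j < 1 := lt_of_le_of_ne (hw1 j) fun h4 => hij (hwinj (h.trans h4.symm))
          rw [h, one_mul]
          exact h3
      have h3 : ((1 - (w i * w j) ^ 2 : ℝ) : ℂ) ≠ 0 := by
        have := mul_pos (hw0 i) (hw0 j)
        exact Complex.ofReal_ne_zero.mpr (by nlinarith)
      refine (mul_eq_zero.mp ?_).resolve_left h3
      push_cast
      linear_combination h1
  refine ⟨(Matrix.of x)ᵀ, ?_, ?_⟩
  · rw [rank_transpose]
    simpa using LinearIndependent.rank_matrix (M := Matrix.of x) hLI
  · have hH : ((Matrix.of x)ᵀ)ᴴ = Matrix.of x := by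
      ext i j
      exact star_dampedSineVec n i (w i) j
    have h0 : Matrix.of x * A * (Matrix.of x)ᵀ = 0 := by
      ext i j
      rw [Matrix.mul_assoc]
      exact hzero i j
    rw [hH, ← sub_eq_zero, ← h0, hA]
    rw [Matrix.mul_sub, Matrix.sub_mul, Matrix.mul_smul, Matrix.smul_mul, Matrix.mul_one]

/-! ### Reduction to real points and conclusion -/

theorem exists_unit_mul_eq_norm (c : ℂ) : ∃ u : ℂ, star u * u = 1 ∧ u * ‖c‖ = c := by
  refine ⟨Complex.exp (Complex.arg c * Complex.I), ?_, ?_⟩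
  · have h : star (Complex.exp (Complex.arg c * Complex.I)) *
        Complex.exp (Complex.arg c * Complex.I) =
          (‖Complex.exp (Complex.arg c * Complex.I)‖ : ℂ) ^ 2 :=
      Complex.conj_mul' _
    rw [h, Complex.norm_exp_ofReal_mul_I]
    simp
  · rw [mul_comm, Complex.norm_mul_exp_arg_mul_I]

theorem mem_rankNumericalRange_shiftMatrix_iff_norm {n k : ℕ} {c : ℂ} :
    c ∈ rankNumericalRange k (shiftMatrix n) ↔
      (‖c‖ : ℂ) ∈ rankNumericalRange k (shiftMatrix n) := by
  obtain ⟨u, hu, huc⟩ := exists_unit_mul_eq_norm c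
  constructor
  · intro h
    have := mul_mem_rankNumericalRange_shiftMatrix (u := star u) (by rwa [star_star, mul_comm]) h
    rwa [← huc, ← mul_assoc, hu, one_mul] at this
  · intro h
    have := mul_mem_rankNumericalRange_shiftMatrix hu h
    rwa [huc] at this

theorem mem_rankNumericalRange_backwardShiftMatrix_iff {n k : ℕ} {c : ℂ} :
    c ∈ rankNumericalRange k (backwardShiftMatrix n) ↔
      star c ∈ rankNumericalRange k (shiftMatrix n) := by
  rw [backwardShiftMatrix_eq_transpose, ← conjTranspose_shiftMatrix]
  constructor
  · intro h
    simpa using mem_rankNumericalRange_conjTranspose h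
  · intro h
    simpa using mem_rankNumericalRange_conjTranspose h

theorem cos_shiftAngle_neg {n k : ℕ} (hk : k < n) (hlt : n + 1 < 2 * (k + 1)) :
    Real.cos (shiftAngle n k) < 0 := by
  have h1 : Real.pi / 2 < shiftAngle n k := by
    have h2 : ((n : ℝ) + 1) < 2 * (k + 1) := by exact_mod_cast hlt
    have h3 : (0 : ℝ) < n + 1 := by positivity
    rw [shiftAngle, div_lt_div_iff₀ two_pos h3]
    nlinarith [Real.pi_pos]
  have h2 := (shiftAngle_mem_Ioo hk).2
  exact Real.cos_neg_of_pi_div_two_lt_of_lt h1 (by linarith [Real.pi_pos])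

theorem mem_rankNumericalRange_shiftMatrix_iff {n k : ℕ} (hk : k < n) {c : ℂ} :
    c ∈ rankNumericalRange (k + 1) (shiftMatrix n) ↔ ‖c‖ ≤ Real.cos (shiftAngle n k) := by
  rw [mem_rankNumericalRange_shiftMatrix_iff_norm]
  refine ⟨le_cos_of_ofReal_mem_rankNumericalRange_shiftMatrix hk, fun h => ?_⟩
  -- The pencil argument needs `r ≠ 0` to invert `Sᵀ - r`, so the centre is separate.
  rcases (norm_nonneg c).eq_or_lt with h0 | h0
  · rw [← h0, Complex.ofReal_zero]
    refine zero_mem_rankNumericalRange_shiftMatrix ?_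
    by_contra! hlt
    have := cos_shiftAngle_neg hk hlt
    linarith
  · exact ofReal_mem_rankNumericalRange_shiftMatrix hk h0 h

theorem corollary3p5 (n k : ℕ) (hk : 1 ≤ k) (hkn : k ≤ n) :
    (k ≤ (n + 1) / 2 →
      rankNumericalRange k (shiftMatrix n) =
          Metric.closedBall (0 : ℂ) (Real.cos ((k : ℝ) * Real.pi / ((n : ℝ) + 1))) ∧
        rankNumericalRange k (backwardShiftMatrix n) =
          Metric.closedBall (0 : ℂ) (Real.cos ((k : ℝ) * Real.pi / ((n : ℝ) + 1)))) ∧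
    ((n + 1) / 2 < k →
      rankNumericalRange k (shiftMatrix n) = ∅ ∧
        rankNumericalRange k (backwardShiftMatrix n) = ∅) := by
  obtain ⟨k, rfl⟩ : ∃ m, k = m + 1 := ⟨k - 1, by omega⟩
  have hkn' : k < n := hkn
  have hangle : ((k + 1 : ℕ) : ℝ) * Real.pi / ((n : ℝ) + 1) = shiftAngle n k := by
    rw [shiftAngle, Nat.cast_add_one]
  have hS : rankNumericalRange (k + 1) (shiftMatrix n) =
      Metric.closedBall (0 : ℂ) (Real.cos (shiftAngle n k)) := by
    ext c
    rw [mem_rankNumericalRange_shiftMatrix_iff hkn', mem_closedBall_zero_iff]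
  have hB : rankNumericalRange (k + 1) (backwardShiftMatrix n) =
      Metric.closedBall (0 : ℂ) (Real.cos (shiftAngle n k)) := by
    ext c
    rw [mem_rankNumericalRange_backwardShiftMatrix_iff,
      mem_rankNumericalRange_shiftMatrix_iff hkn', mem_closedBall_zero_iff, norm_star]
  rw [hangle, hS, hB]
  refine ⟨fun _ => ⟨rfl, rfl⟩, fun hlt => ?_⟩
  have hneg := cos_shiftAngle_neg hkn' (by omega)
  exact ⟨Metric.closedBall_eq_empty.mpr hneg, Metric.closedBall_eq_empty.mpr hneg⟩
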